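/- Let $\mathcal{A}$ be a semi-abelian category (pointed, Barr exact, Bourn protomodular, with binary coproducts) with enough projectives: for every object $A$ there is a \emph{projective presentation} $f\colon B\to A$, i.e. a regular epimorphism whose domain $B$ is projective with respect to regular epimorphisms. Let $\mathcal{B}$ be a Birkhoff subcategory of $\mathcal{A}$, i.e. a full reflective subcategory closed under subobjects and regular quotients, with reflector $I\colon\mathcal{A}\to\mathcal{B}$ and unit $\eta$. An \emph{extension} is a regular epimorphism. An extension $f\colon B\to A$ is \emph{$\mathcal{B}$-trivial} if the square $\eta_A\circ f=I(f)\circ\eta_B$ is a pullback, and \emph{$\mathcal{B}$-central} if its pullback along some extension $g\colon C\to A$ is $\mathcal{B}$-trivial. An object $A$ is \emph{$\mathcal{B}$-perfect} if $I(A)=0$. A $\mathcal{B}$-central extension $u\colon U\to A$ is \emph{universal} if for every $\mathcal{B}$-central extension $f\colon B\to A$ there is a unique $h\colon U\to B$ with $f\circ h=u$. Write $\mu_A\colon[A,A]_{\mathcal{B}}\to A$ for the kernel of $\eta_A$; this gives a functor $[-,-]_{\mathcal{B}}$. For an extension $f\colon B\to A$ with kernel $K$ and kernel pair projections $f_0,f_1\colon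 B\times_AB\to B$, let $[K,B]_{\mathcal{B}}$ be the kernel of $[f_0,f_0]_{\mathcal{B}}$, regarded as a subobject of $[B,B]_{\mathcal{B}}$ via $[f_1,f_1]_{\mathcal{B}}$, and as a subobject of $B$ via $\mu_B\circ[f_1,f_1]_{\mathcal{B}}$; it is contained in $K\wedge[B,B]_{\mathcal{B}}$. For a projective presentation $f\colon B\to A$ with kernel $K$, put \[ U(A,I)=\frac{[B,B]_{\mathcal{B}}}{[K,B]_{\mathcal{B}}},\qquad H_2(A,I)=\frac{K\wedge[B,B]_{\mathcal{B}}}{[K,B]_{\mathcal{B}}}. \] \textbf{Theorem.} An object $A$ of $\mathcal{A}$ is $\mathcal{B}$-perfect if and only if it admits a universal $\mathcal{B}$-central extension. Moreover, if $A$ is $\mathcal{B}$-perfect then, for every projective presentation $f\colon B\to A$, the above quotients exist and there is a short exact sequence \[ 0\to H_2(A,I)\to U(A,I)\xrightarrow{\;u\;}A\to 0 \] in which the first map is induced by the inclusion $K\wedge[B,B]_{\mathcal{B}}\to[B,B]_{\mathcal{B}}$, the map $u$ is induced by $f\circ\mu_B$, and $u$ is a universal $\mathcal{B}$-central extension of $A$.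 -/

import Mathlib

open CategoryTheory CategoryTheory.Limits

universe v u

/-- A pointed category is *semi-abelian* when it has binary coproducts, is Barr exact (regular, and
every internal equivalence relation is a kernel pair) and is Bourn protomodular. For a pointed
regular category the latter means that the regular Short Five Lemma holds. -/
class SemiAbelian (C : Type u) [Category.{v} C] [HasZeroMorphisms C] : Prop
    extends Regular C where
  hasZeroObject : HasZeroObject C
  hasBinaryCoproducts : HasBinaryCoproducts C
  exists_isKernelPair : ∀ {R X : C} (p₁ p₂ : R ⟶ X), IsEquivalenceRelation p₁ p₂ →
    ∃ (Y : C) (f : X ⟶ Y), IsKernelPair f p₁ p₂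
  short_five : ∀ {B' A' B A : C} (f' : B' ⟶ A') (f : B ⟶ A) (b : B' ⟶ B) (a : A' ⟶ A)
    (w : f' ≫ a = b ≫ f), IsRegularEpi f' → IsRegularEpi f →
    IsIso (kernel.map f' f b a w) → IsIso a → IsIso b

namespace SemiAbelian

section Projectives

variable {C : Type u} [Category.{v} C]

/-- `X` is projective with respect to all regular epimorphisms. -/
def IsRegularProjective (X : C) : Prop :=
  ∀ {E Y : C} (g : X ⟶ Y) (e : E ⟶ Y), IsRegularEpi e → ∃ g' : X ⟶ E, g' ≫ e = g

/-- A projective presentation of `A`: a regular epimorphism to `A` from a projective object. -/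
def IsProjectivePresentation {X A : C} (p : X ⟶ A) : Prop :=
  IsRegularProjective X ∧ IsRegularEpi p

variable (C) in
/-- Every object has a projective presentation. -/
def EnoughRegularProjectives : Prop :=
  ∀ A : C, ∃ (X : C) (p : X ⟶ A), IsProjectivePresentation p

/-- The full subcategory on the objects satisfying `P` (assumed reflective separately, through
`Reflective P.ι`) is a *Birkhoff subcategory*: it is closed under subobjects and regular
quotients. -/
structure IsBirkhoff (P : ObjectProperty C) [Reflective P.ι] : Prop where
  of_mono : ∀ {X Y : C} (m : X ⟶ Y), Mono m → P Y → P X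
  of_regularEpi : ∀ {X Y : C} (e : X ⟶ Y), IsRegularEpi e → P X → P Y

end Projectives

section Central

variable {C : Type u} [Category.{v} C] (P : ObjectProperty C) [Reflective P.ι]

/-- The reflection of `A` in the subcategory, seen as an object of the ambient category. -/
noncomputable abbrev refl (A : C) : C := P.ι.obj ((reflector P.ι).obj A)

/-- The reflection of a morphism, seen in the ambient category. -/
noncomputable abbrev reflMap {B A : C} (f : B ⟶ A) : refl P B ⟶ refl P A :=
  P.ι.map ((reflector P.ι).map f)

/-- The unit of the reflection. -/
noncomputable abbrev eta (A : C) : A ⟶ refl P A := (reflectorAdjunction P.ι).unit.app A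

lemma eta_naturality {B A : C} (f : B ⟶ A) : eta P B ≫ reflMap P f = f ≫ eta P A :=
  ((reflectorAdjunction P.ι).unit.naturality f).symm

/-- `A` is perfect: its reflection is the zero object of the subcategory. -/
def IsPerfect (A : C) : Prop := IsZero ((reflector P.ι).obj A)

/-- A trivial extension: a regular epimorphism whose naturality square for the unit is a
pullback. -/
def IsTrivialExtension {B A : C} (f : B ⟶ A) : Prop :=
  IsRegularEpi f ∧ IsPullback f (eta P B) (eta P A) (reflMap P f)

/-- A central extension: a regular epimorphism `f : B ⟶ A` whose pullback along some regular
epimorphism `g : E ⟶ A` is a trivial extension. -/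
def IsCentralExtension [HasPullbacks C] {B A : C} (f : B ⟶ A) : Prop :=
  IsRegularEpi f ∧
    ∃ (E : C) (g : E ⟶ A), IsRegularEpi g ∧ IsTrivialExtension P (pullback.fst g f)

/-- A universal central extension of `A`: an initial object among the central extensions
of `A`, as a full subcategory of the slice category over `A`. -/
def IsUniversalCentralExtension [HasPullbacks C] {U A : C} (u : U ⟶ A) : Prop :=
  IsCentralExtension P u ∧
    ∀ {B : C} (f : B ⟶ A), IsCentralExtension P f → ∃! h : U ⟶ B, h ≫ f = u

end Central

section Commutators

variable {C : Type u} [Category.{v} C] [HasZeroMorphisms C]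

/-- `0 ⟶ K ⟶ X ⟶ Q ⟶ 0` is short exact: `k` is the kernel of `q` and `q` is the cokernel of
`k`. We then also say that `Q` is the quotient `X / K` of `X` by `K`. -/
def IsShortExact {K X Q : C} (k : K ⟶ X) (q : X ⟶ Q) : Prop :=
  ∃ w : k ≫ q = 0, Nonempty (IsLimit (KernelFork.ofι k w)) ∧
    Nonempty (IsColimit (CokernelCofork.ofπ q w))

variable [HasFiniteLimits C] (P : ObjectProperty C) [Reflective P.ι]

/-- The zero-dimensional commutator `[A, A]`: the kernel of the unit of the reflection. -/
noncomputable abbrev comm₀ (A : C) : C := kernel (eta P A)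

/-- The inclusion `[A, A] ⟶ A`. -/
noncomputable abbrev mu (A : C) : comm₀ P A ⟶ A := kernel.ι (eta P A)

/-- The functorial action `[f, f] : [B, B] ⟶ [A, A]`. -/
noncomputable abbrev comm₀Map {B A : C} (f : B ⟶ A) : comm₀ P B ⟶ comm₀ P A :=
  kernel.map (eta P B) (eta P A) f (reflMap P f) (eta_naturality P f)

/-- The one-dimensional commutator `[K, B]` of an extension `f : B ⟶ A` with kernel `K`: the
kernel of `[f₀, f₀]`, where `f₀, f₁` are the projections of the kernel pair of `f`. -/
noncomputable abbrev comm₁ {B A : C} (f : B ⟶ A) : C := kernel (comm₀Map P (pullback.fst f f))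

/-- The comparison `[K, B] ⟶ [B, B]`, namely the restriction of `[f₁, f₁]`. -/
noncomputable def comm₁ToComm₀ {B A : C} (f : B ⟶ A) : comm₁ P f ⟶ comm₀ P B :=
  kernel.ι (comm₀Map P (pullback.fst f f)) ≫ comm₀Map P (pullback.snd f f)

/-- The intersection `K ∧ [B, B]` of subobjects of `B`, with `K` the kernel of `f : B ⟶ A`. -/
noncomputable abbrev meet {B A : C} (f : B ⟶ A) : C := pullback (kernel.ι f) (mu P B)

/-- The inclusion `K ∧ [B, B] ⟶ [B, B]`. -/
noncomputable abbrev meetToComm₀ {B A : C} (f : B ⟶ A) : meet P f ⟶ comm₀ P B :=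
  pullback.snd (kernel.ι f) (mu P B)

lemma comm₁ToComm₀_comp {B A : C} (f : B ⟶ A) : (comm₁ToComm₀ P f ≫ mu P B) ≫ f = 0 := by
  have h₁ : comm₀Map P (pullback.snd f f) ≫ mu P B =
      mu P (pullback f f) ≫ pullback.snd f f := kernel.lift_ι _ _ _
  have h₀ : comm₀Map P (pullback.fst f f) ≫ mu P B =
      mu P (pullback f f) ≫ pullback.fst f f := kernel.lift_ι _ _ _
  have h := kernel.condition (comm₀Map P (pullback.fst f f))
  unfold comm₁ToComm₀
  rw [Category.assoc, Category.assoc, reassoc_of% h₁, ← pullback.condition, ← reassoc_of% h₀,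
    reassoc_of% h, zero_comp]

/-- The inclusion `[K, B] ⟶ K ∧ [B, B]` over `B`. -/
noncomputable def comm₁ToMeet {B A : C} (f : B ⟶ A) : comm₁ P f ⟶ meet P f :=
  pullback.lift (kernel.lift f (comm₁ToComm₀ P f ≫ mu P B) (comm₁ToComm₀_comp P f))
    (comm₁ToComm₀ P f) (kernel.lift_ι _ _ _)

/-- `q` exhibits `U` as the Baer invariant `[B, B] / [K, B]` computed from `f : B ⟶ A`. -/
def IsBaerU {B A : C} (f : B ⟶ A) {U : C} (q : comm₀ P B ⟶ U) : Prop :=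
  IsShortExact (comm₁ToComm₀ P f) q

/-- `r` exhibits `H` as the second homology object given by the Hopf formula
`(K ∧ [B, B]) / [K, B]` computed from `f : B ⟶ A`. -/
def IsHopfH₂ {B A : C} (f : B ⟶ A) {H : C} (r : meet P f ⟶ H) : Prop :=
  IsShortExact (comm₁ToMeet P f) r

end Commutators

end SemiAbelian

/-! The functor `[-, -]` preserves regular epimorphisms (`exists_local_lift_comm₀`), because
reflecting an extension gives a regular pushout. Hence `f` is central exactly when its two kernel
pair projections agree on elements killed by the unit (`isCentralExtension_iff`).

Let `R` be the kernel pair of `f : B ⟶ A`. The reflexive relation `[R, R]` on `[B, B]` is effective,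
and its quotient `q` realises `[B, B] / [K, B]`. If `A` is perfect, `[B, B]` covers `[A, A] = A`, so
`mu P B ≫ f` induces a regular epimorphism `u : U ⟶ A`. It is central because `q` identifies `[R,
R]`-related elements. Projectivity of `B` gives maps from `u` to any central extension, and
perfectness of `U` makes them unique.

Conversely, a universal `u` has two maps over `A` to `A ⨯ refl P A`, namely `(u, u ≫ eta P A)` and
`(u, 0)`; their equality forces `eta P A = 0`. -/

namespace SemiAbelian

/-! ### Regular categories: images, relations and local lifting -/

section Regular

variable {C : Type u} [Category.{v} C] [Regular C]

/-- A morphism through which a regular epimorphism factors is a regular epimorphism. -/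
lemma isRegularEpi_of_comp {X Y Z : C} (f : X ⟶ Y) (g : Y ⟶ Z) (h : X ⟶ Z) (w : f ≫ g = h)
    (hh : IsRegularEpi h) : IsRegularEpi g := by
  subst w
  have : StrongEpi g := strongEpi_of_strongEpi f g
  infer_instance

lemma isRegularEpi_comp {X Y Z : C} (f : X ⟶ Y) (g : Y ⟶ Z) (hf : IsRegularEpi f)
    (hg : IsRegularEpi g) : IsRegularEpi (f ≫ g) := by
  have : StrongEpi (f ≫ g) := strongEpi_comp f g
  infer_instance

lemma isRegularEpi_of_section {X Y : C} (p : X ⟶ Y) (s : Y ⟶ X) (w : s ≫ p = 𝟙 Y) :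
    IsRegularEpi p :=
  have : IsSplitEpi p := .mk' ⟨s, w⟩
  inferInstance

lemma isRegularEpi_pullback_fst {X Y B : C} (f : X ⟶ B) (g : Y ⟶ B) (hg : IsRegularEpi g) :
    IsRegularEpi (pullback.fst f g) := inferInstance

omit [Regular C] in
lemma epi_of_isRegularEpi {X Y : C} {f : X ⟶ Y} (hf : IsRegularEpi f) : Epi f := inferInstance

/-- A generalized element of the target of a regular epimorphism lifts locally. -/
lemma exists_local_lift {X Y T : C} (f : X ⟶ Y) (hf : IsRegularEpi f) (y : T ⟶ Y) :
    ∃ (T' : C) (c : T' ⟶ T) (x : T' ⟶ X), IsRegularEpi c ∧ x ≫ f = c ≫ y :=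
  ⟨_, pullback.snd f y, pullback.fst f y, inferInstance, pullback.condition⟩

lemma exists_image {X Y : C} (f : X ⟶ Y) :
    ∃ (I : C) (e : X ⟶ I) (m : I ⟶ Y), IsRegularEpi e ∧ Mono m ∧ e ≫ m = f :=
  ⟨_, (Regular.strongEpiMonoFactorisation f).e, (Regular.strongEpiMonoFactorisation f).m,
    inferInstance, inferInstance, by simp⟩

lemma exists_desc {X Y Z : C} (f : X ⟶ Y) (hf : IsRegularEpi f) (g : X ⟶ Z)
    (w : pullback.fst f f ≫ g = pullback.snd f f ≫ g) : ∃ h : Y ⟶ Z, f ≫ h = g :=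
  IsRegularEpi.exists_of_isKernelPair f (.of_hasPullback f) g w

lemma exists_isPullback {X Y Z : C} (f : X ⟶ Z) (g : Y ⟶ Z) :
    ∃ (W : C) (a : W ⟶ X) (b : W ⟶ Y), IsPullback a b f g :=
  ⟨_, _, _, .of_hasPullback f g⟩

/-- The inverse image of a relation along a pair of morphisms. -/
lemma exists_relation_preimage {N X Y Z : C} (n₀ : N ⟶ X) (n₁ : N ⟶ Y) (hn : JointlyMono₂ n₀ n₁)
    (g₀ : Z ⟶ X) (g₁ : Z ⟶ Y) :
    ∃ (M : C) (m : M ⟶ Z) (k : M ⟶ N), Mono m ∧ m ≫ g₀ = k ≫ n₀ ∧ m ≫ g₁ = k ≫ n₁ ∧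
      ∀ {T : C} (z : T ⟶ Z) (x : T ⟶ N), z ≫ g₀ = x ≫ n₀ → z ≫ g₁ = x ≫ n₁ →
        ∃ l : T ⟶ M, l ≫ m = z := by
  obtain ⟨M, m, k, h⟩ := exists_isPullback (prod.lift g₀ g₁) (prod.lift n₀ n₁)
  have h₀ : m ≫ g₀ = k ≫ n₀ := by
    have := congr($(h.w) ≫ prod.fst)
    rwa [Category.assoc, Category.assoc, prod.lift_fst, prod.lift_fst] at this
  have h₁ : m ≫ g₁ = k ≫ n₁ := by
    have := congr($(h.w) ≫ prod.snd)
    rwa [Category.assoc, Category.assoc, prod.lift_snd, prod.lift_snd] at this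
  refine ⟨M, m, k, ⟨fun x y e => h.hom_ext e ?_⟩, h₀, h₁, fun z x e₀ e₁ => ?_⟩
  · apply hn.right_cancellation
    · rw [Category.assoc, Category.assoc, ← h₀, reassoc_of% e]
    · rw [Category.assoc, Category.assoc, ← h₁, reassoc_of% e]
  · obtain ⟨l, hl, -⟩ := h.exists_lift z x (by
      rw [prod.comp_lift, prod.comp_lift, e₀, e₁])
    exact ⟨l, hl⟩

/-- The image of a pair of morphisms is a relation. -/
lemma exists_relation_image {X Y Z : C} (f : Z ⟶ X) (g : Z ⟶ Y) :
    ∃ (N : C) (e : Z ⟶ N) (n₀ : N ⟶ X) (n₁ : N ⟶ Y), IsRegularEpi e ∧ JointlyMono₂ n₀ n₁ ∧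
      e ≫ n₀ = f ∧ e ≫ n₁ = g := by
  obtain ⟨N, e, m, he, hm, h⟩ := exists_image (prod.lift f g)
  refine ⟨N, e, m ≫ prod.fst, m ≫ prod.snd, he, ⟨fun _ x y h₀ h₁ => ?_⟩, ?_, ?_⟩
  · rw [← cancel_mono m]
    apply Limits.prod.hom_ext
    · rwa [Category.assoc, Category.assoc]
    · rwa [Category.assoc, Category.assoc]
  · rw [reassoc_of% h, prod.lift_fst]
  · rw [reassoc_of% h, prod.lift_snd]

/-- Membership in a relation is a local property. -/
lemma exists_lift_relation_of_local {N X Y T T' : C} (n₀ : N ⟶ X) (n₁ : N ⟶ Y)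
    (hn : JointlyMono₂ n₀ n₁) (c : T' ⟶ T) (hc : IsRegularEpi c) (x : T ⟶ X) (y : T ⟶ Y)
    (l : T' ⟶ N) (h₀ : l ≫ n₀ = c ≫ x) (h₁ : l ≫ n₁ = c ≫ y) :
    ∃ l' : T ⟶ N, l' ≫ n₀ = x ∧ l' ≫ n₁ = y := by
  have := epi_of_isRegularEpi hc
  obtain ⟨g, hg⟩ := exists_desc c hc l (hn.right_cancellation _ _
    (by rw [Category.assoc, Category.assoc, h₀, pullback.condition_assoc])
    (by rw [Category.assoc, Category.assoc, h₁, pullback.condition_assoc]))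
  exact ⟨g, by rw [← cancel_epi c, reassoc_of% hg, h₀],
    by rw [← cancel_epi c, reassoc_of% hg, h₁]⟩

end Regular

/-! ### Protomodularity: cokernels, difunctionality, effective reflexive relations -/

section Protomodular

variable {C : Type u} [Category.{v} C] [HasZeroMorphisms C] [SemiAbelian C]

/-- The Short Five Lemma, with the hypothesis on kernels stated elementwise. -/
lemma isIso_of_kernel {M X Q : C} (p : M ⟶ Q) (p' : X ⟶ Q) (m : M ⟶ X) (hm : Mono m)
    (w : m ≫ p' = p) (hp : IsRegularEpi p) (hp' : IsRegularEpi p')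
    (h : ∃ l : kernel p' ⟶ M, l ≫ m = kernel.ι p') : IsIso m := by
  obtain ⟨l, hl⟩ := h
  have hlp : l ≫ p = 0 := by rw [← w, reassoc_of% hl, kernel.condition]
  refine SemiAbelian.short_five p p' m (𝟙 Q) (by simp [w]) hp hp' ?_ inferInstance
  refine ⟨kernel.lift p l hlp, ?_, ?_⟩
  · rw [← cancel_mono (kernel.ι p), ← cancel_mono m]
    simp [hl]
  · rw [← cancel_mono (kernel.ι p')]
    simp [hl]

/-- Regular epimorphisms are cokernels of their kernels. -/
lemma exists_desc_of_kernel {X Y Z : C} (f : X ⟶ Y) (hf : IsRegularEpi f) (g : X ⟶ Z)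
    (w : kernel.ι f ≫ g = 0) : ∃ h : Y ⟶ Z, f ≫ h = g := by
  apply exists_desc f hf
  let f₀ := pullback.fst f f
  let f₁ := pullback.snd f f
  -- This subobject of the kernel pair contains the diagonal and the kernel of `f₀`, which `f₁`
  -- sends into the kernel of `f`; so it is everything.
  let m := equalizer.ι (f₀ ≫ g) (f₁ ≫ g)
  have hd : pullback.diagonal f ≫ f₀ ≫ g = pullback.diagonal f ≫ f₁ ≫ g := by simp [f₀, f₁]
  have : IsIso m := by
    refine isIso_of_kernel (m ≫ f₀) f₀ m inferInstance rfl ?_ ?_ ?_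
    · exact isRegularEpi_of_section _ (equalizer.lift _ hd) (by simp [m, f₀])
    · exact isRegularEpi_of_section _ (pullback.diagonal f) (by simp [f₀])
    · have h0 : (kernel.ι f₀ ≫ f₁) ≫ f = 0 := by
        rw [Category.assoc, ← pullback.condition, kernel.condition_assoc, zero_comp]
      refine ⟨equalizer.lift (kernel.ι f₀) ?_, equalizer.lift_ι _ _⟩
      have := kernel.lift_ι f _ h0
      rw [kernel.condition_assoc, zero_comp, ← Category.assoc, ← this, Category.assoc, w, comp_zero]
  rw [← cancel_epi m]
  exact equalizer.condition _ _

/-- A regular epimorphism with trivial kernel is an isomorphism. -/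
lemma isIso_of_kernel_eq_zero {X Y : C} (f : X ⟶ Y) (hf : IsRegularEpi f)
    (h : kernel.ι f = 0) : IsIso f := by
  obtain ⟨g, hg⟩ := exists_desc_of_kernel f hf (𝟙 X) (by rw [h, zero_comp])
  have := epi_of_isRegularEpi hf
  exact ⟨g, hg, by rw [← cancel_epi f, reassoc_of% hg, Category.comp_id]⟩

/-- The pullback of two split epimorphisms is covered by the two induced inclusions. -/
lemma isIso_of_factors {A B Q X M : C} {a : X ⟶ A} {b : X ⟶ B} {p : A ⟶ Q} {q : B ⟶ Q}
    (h : IsPullback a b p q) (s : Q ⟶ A) (hp : s ≫ p = 𝟙 Q) (t : Q ⟶ B)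
    (m : M ⟶ X) (hm : Mono m) (i : A ⟶ M) (hi₁ : i ≫ m ≫ a = 𝟙 A) (hi₂ : i ≫ m ≫ b = p ≫ t)
    (j : B ⟶ M) (hj₂ : j ≫ m ≫ b = 𝟙 B) : IsIso m := by
  refine isIso_of_kernel (m ≫ b) b m hm rfl (isRegularEpi_of_section _ j hj₂) ?_
    -- An element of `kernel b` is a pair `(α, 0)` with `p α = 0`, and `i` sends `α` to `(α, t (p
    -- α)) = (α, 0)`.
    ⟨kernel.ι b ≫ a ≫ i, ?_⟩
  · exact isRegularEpi_of_section _ (h.lift (q ≫ s) (𝟙 _) (by simp [hp])) (by simp)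
  · apply h.hom_ext
    · simp [hi₁]
    · simp only [Category.assoc, hi₂]
      rw [h.w_assoc]
      simp

/-- Every relation in a semi-abelian category is difunctional. -/
lemma difunctional {N X Y T : C} (n₀ : N ⟶ X) (n₁ : N ⟶ Y) (hn : JointlyMono₂ n₀ n₁)
    (a b c : T ⟶ N) (hab : a ≫ n₁ = b ≫ n₁) (hbc : b ≫ n₀ = c ≫ n₀) :
    ∃ d : T ⟶ N, d ≫ n₀ = a ≫ n₀ ∧ d ≫ n₁ = c ≫ n₁ := by
  obtain ⟨A, x, p, hA⟩ := exists_isPullback n₁ n₁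
  obtain ⟨B, q, y, hB⟩ := exists_isPullback n₀ n₀
  obtain ⟨Z, v, w, hZ⟩ := exists_isPullback p q
  -- `Z` consists of the zigzags `(a, b, c)` and `M` of those admitting a `d`. If `b = c` take `d =
  -- a`; if `a = b` take `d = c`. These two cases cover `Z`.
  obtain ⟨M, m, k, hm, hmk₀, hmk₁, hM⟩ :=
    exists_relation_preimage n₀ n₁ hn (v ≫ x ≫ n₀) (w ≫ y ≫ n₁)
  obtain ⟨s, hs₀, hs₁⟩ := hA.exists_lift (𝟙 N) (𝟙 N) rfl
  obtain ⟨t, ht₀, ht₁⟩ := hB.exists_lift (𝟙 N) (𝟙 N) rfl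
  obtain ⟨i, hi⟩ := hM (hZ.lift (𝟙 _) (p ≫ t) (by simp [ht₀])) x (by simp)
    (by simp [reassoc_of% ht₁, hA.w])
  obtain ⟨j, hj⟩ := hM (hZ.lift (q ≫ s) (𝟙 _) (by simp [hs₁])) y
    (by simp [reassoc_of% hs₀, hB.w]) (by simp)
  have : IsIso m := isIso_of_factors hZ s hs₁ t m hm i (by simp [reassoc_of% hi])
    (by simp [reassoc_of% hi]) j (by simp [reassoc_of% hj])
  obtain ⟨z, hz₀, hz₁⟩ := hZ.exists_lift (hA.lift a b hab) (hB.lift b c hbc) (by simp)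
  refine ⟨z ≫ inv m ≫ k, ?_, ?_⟩
  · simp only [Category.assoc, ← hmk₀, IsIso.inv_hom_id_assoc, reassoc_of% hz₀]
    simp
  · simp only [Category.assoc, ← hmk₁, IsIso.inv_hom_id_assoc, reassoc_of% hz₁]
    simp

/-- Every reflexive relation is effective: it is the kernel pair of a regular epimorphism. -/
lemma exists_isKernelPair_of_reflexive {R X : C} (r₀ r₁ : R ⟶ X) (hr : JointlyMono₂ r₀ r₁)
    (s : X ⟶ R) (h₀ : s ≫ r₀ = 𝟙 X) (h₁ : s ≫ r₁ = 𝟙 X) :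
    ∃ (Y : C) (f : X ⟶ Y), IsRegularEpi f ∧ IsKernelPair f r₀ r₁ := by
  -- Symmetry from the zigzag `(y, y)`, `(x, y)`, `(x, x)`; transitivity below from `(x, y)`, `(y,
  -- y)`, `(y, z)`.
  obtain ⟨σ, hσ₀, hσ₁⟩ := difunctional r₀ r₁ hr (r₁ ≫ s) (𝟙 R) (r₀ ≫ s) (by simp [h₁])
    (by simp [h₀])
  obtain ⟨τ, hτ₀, hτ₁⟩ := difunctional r₀ r₁ hr (pullback.fst r₁ r₀)
    (pullback.fst r₁ r₀ ≫ r₁ ≫ s) (pullback.snd r₁ r₀) (by simp [h₁])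
    (by simp [h₀, pullback.condition])
  have he : EquivalenceRelation r₀ r₁ :=
    { hr with
      r := s
      reflexivity₁ := h₀
      reflexivity₂ := h₁
      s := σ
      symmetry₁ := by simp [hσ₀, h₀]
      symmetry₂ := by simp [hσ₁, h₁]
      c := pullback.cone r₁ r₀
      isLimit := pullback.isLimit r₁ r₀
      t := τ
      transitivity₁ := hτ₀
      transitivity₂ := hτ₁ }
  obtain ⟨Y, f, hf⟩ := SemiAbelian.exists_isKernelPair r₀ r₁ he.isEquivalenceRelation
  obtain ⟨I, e, m, hE, hm, rfl⟩ := exists_image f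
  exact ⟨I, e, hE, hf.cancel_right_of_mono⟩

end Protomodular

/-! ### The universal property of the unit -/

section Reflection

variable {C : Type u} [Category.{v} C] (P : ObjectProperty C) [Reflective P.ι]

lemma prop_refl (A : C) : P (refl P A) := ((reflector P.ι).obj A).property

lemma exists_refl_desc {A X : C} (hX : P X) (f : A ⟶ X) : ∃ g : refl P A ⟶ X, eta P A ≫ g = f := by
  refine ⟨P.ι.map (((reflectorAdjunction P.ι).homEquiv A ⟨X, hX⟩).symm f), ?_⟩
  rw [← Adjunction.homEquiv_unit, Equiv.apply_symm_apply]

lemma refl_hom_ext {A X : C} (hX : P X) (g g' : refl P A ⟶ X) (h : eta P A ≫ g = eta P A ≫ g') :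
    g = g' := by
  obtain ⟨k, rfl⟩ := P.ι.map_surjective (Y := ⟨X, hX⟩) g
  obtain ⟨k', rfl⟩ := P.ι.map_surjective (Y := ⟨X, hX⟩) g'
  congr 1
  apply ((reflectorAdjunction P.ι).homEquiv A ⟨X, hX⟩).injective
  rwa [Adjunction.homEquiv_unit, Adjunction.homEquiv_unit]

/-- Elements killed by the unit are preserved by every morphism. -/
lemma comp_eta_eq_zero [HasZeroMorphisms C] {A B T : C} (x : T ⟶ B) (hx : x ≫ eta P B = 0)
    (f : B ⟶ A) : (x ≫ f) ≫ eta P A = 0 := by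
  rw [Category.assoc, ← eta_naturality, reassoc_of% hx, zero_comp]

lemma isPerfect_iff [HasZeroMorphisms C] (A : C) : IsPerfect P A ↔ eta P A = 0 := by
  have key : eta P A = 0 ↔ 𝟙 (refl P A) = 0 := by
    constructor
    · intro h
      apply refl_hom_ext P (prop_refl P A)
      rw [h, zero_comp, zero_comp]
    · intro h
      rw [← Category.comp_id (eta P A), h, comp_zero]
  rw [key]
  constructor
  · intro h
    obtain ⟨k, hk⟩ := P.ι.map_surjective (X := (reflector P.ι).obj A)
      (Y := (reflector P.ι).obj A) 0
    rw [← hk, ← P.ι.map_id, h.eq_of_src (𝟙 _) k]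
  · intro h
    have h' : IsZero (refl P A) := ⟨fun Y => ⟨⟨⟨0⟩, fun f => by
      rw [← Category.id_comp f, h, zero_comp]; rfl⟩⟩, fun Y => ⟨⟨⟨0⟩, fun f => by
      rw [← Category.comp_id f, h, comp_zero]; rfl⟩⟩⟩
    refine ⟨fun Y => ⟨⟨⟨P.ι.preimage 0⟩, fun f => ?_⟩⟩, fun Y => ⟨⟨⟨P.ι.preimage 0⟩, fun f => ?_⟩⟩⟩
    · exact P.ι.map_injective (h'.eq_of_src _ _)
    · exact P.ι.map_injective (h'.eq_of_tgt _ _)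

end Reflection

/-! ### Regular pushouts, trivial and central extensions -/

section Birkhoff

variable {C : Type u} [Category.{v} C] [HasZeroMorphisms C] [SemiAbelian C]
  {P : ObjectProperty C} [Reflective P.ι] (hP : IsBirkhoff P)

include hP

/-- The image of the unit is a subobject of the reflection, hence in the subcategory, so the
universal property splits its inclusion. -/
lemma isRegularEpi_eta (A : C) : IsRegularEpi (eta P A) := by
  obtain ⟨I, e, m, he, hm, h⟩ := exists_image (eta P A)
  obtain ⟨g, hg⟩ := exists_refl_desc P (hP.of_mono m hm (prop_refl P A)) e
  have hgm : g ≫ m = 𝟙 _ := refl_hom_ext P (prop_refl P A) _ _ (by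
    rw [reassoc_of% hg, h, Category.comp_id])
  rw [← h]
  exact isRegularEpi_comp e m he (isRegularEpi_of_section m g hgm)

/-- For a regular epimorphism `f`, the naturality square of the unit at `f` is a regular pushout:
its comparison to the pullback is locally surjective. -/
lemma exists_local_lift_of_eta {B A T : C} (f : B ⟶ A) (hf : IsRegularEpi f) (a : T ⟶ A)
    (y : T ⟶ refl P B) (w : a ≫ eta P A = y ≫ reflMap P f) :
    ∃ (T' : C) (c : T' ⟶ T) (b : T' ⟶ B), IsRegularEpi c ∧ b ≫ f = c ≫ a ∧
      b ≫ eta P B = c ≫ y := by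
  have hη := isRegularEpi_eta hP B
  have := epi_of_isRegularEpi hη
  obtain ⟨S, s₀, s₁, hS⟩ := exists_isPullback (eta P B) (eta P B)
  -- `R` is the direct image along `f` of the kernel pair of `eta P B`. Its quotient `D` is also a
  -- regular quotient of `refl P B`, hence lies in the subcategory, so `R` relates all elements that
  -- `eta P A` identifies.
  obtain ⟨R, e, r₀, r₁, he, hR, her₀, her₁⟩ := exists_relation_image (s₀ ≫ f) (s₁ ≫ f)
  obtain ⟨δ, hδ₀, hδ₁⟩ := hS.exists_lift (𝟙 B) (𝟙 B) rfl
  obtain ⟨ρ, hρ₀, hρ₁⟩ := exists_lift_relation_of_local r₀ r₁ hR f hf (𝟙 A) (𝟙 A) (δ ≫ e)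
    (by rw [Category.assoc, her₀, reassoc_of% hδ₀, Category.comp_id])
    (by rw [Category.assoc, her₁, reassoc_of% hδ₁, Category.comp_id])
  obtain ⟨D, c, hc, hcR⟩ := exists_isKernelPair_of_reflexive r₀ r₁ hR ρ hρ₀ hρ₁
  obtain ⟨d, hd⟩ := IsRegularEpi.exists_of_isKernelPair (eta P B) hS (f ≫ c) (by
    rw [← reassoc_of% her₀, ← reassoc_of% her₁, hcR.w])
  have hD : P D := hP.of_regularEpi d
    (isRegularEpi_of_comp _ _ _ hd (isRegularEpi_comp f c hf hc)) (prop_refl P B)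
  obtain ⟨c', hc'⟩ := exists_refl_desc P hD c
  obtain ⟨N, ν, n₀, n₁, hν, hN, hν₀, hν₁⟩ := exists_relation_image f (eta P B)
  obtain ⟨T₁, t₁, b, ht₁, hb⟩ := exists_local_lift (eta P B) hη y
  obtain ⟨x, hx₀, hx₁⟩ := hcR.lift' (t₁ ≫ a) (b ≫ f) (by
    rw [← hc', Category.assoc, reassoc_of% w, ← reassoc_of% hb, Category.assoc,
      ← reassoc_of% (eta_naturality P f)])
  obtain ⟨T₂, t₂, z, ht₂, hz⟩ := exists_local_lift e he x
  -- With `z = (z₀, z₁)`, the zigzag `(f z₀, η z₀)`, `(f z₁, η z₁)`, `(f b, η b)` yields `(f z₀, η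
  -- b) = (a, y)` in the image of `(f, η)`.
  obtain ⟨n, hn₀, hn₁⟩ := difunctional n₀ n₁ hN (z ≫ s₀ ≫ ν) (z ≫ s₁ ≫ ν) (t₂ ≫ b ≫ ν)
    (by simp [hν₁, hS.w])
    (by rw [Category.assoc, Category.assoc, hν₀, ← her₁, reassoc_of% hz, hx₁]; simp [hν₀])
  obtain ⟨T₃, t₃, b', ht₃, hb'⟩ := exists_local_lift ν hν n
  refine ⟨T₃, t₃ ≫ t₂ ≫ t₁, b', isRegularEpi_comp _ _ ht₃ (isRegularEpi_comp _ _ ht₂ ht₁), ?_, ?_⟩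
  · rw [← hν₀, reassoc_of% hb', hn₀, Category.assoc, Category.assoc, hν₀, ← her₀,
      reassoc_of% hz, hx₀, Category.assoc, Category.assoc]
  · rw [← hν₁, reassoc_of% hb', hn₁, Category.assoc, Category.assoc, hν₁, hb, Category.assoc,
      Category.assoc]

/-- The functor `[-, -]` preserves regular epimorphisms: elements of `[A, A]` lift locally along
an extension. -/
lemma exists_local_lift_comm₀ {B A T : C} (f : B ⟶ A) (hf : IsRegularEpi f) (a : T ⟶ A)
    (ha : a ≫ eta P A = 0) :
    ∃ (T' : C) (c : T' ⟶ T) (b : T' ⟶ B), IsRegularEpi c ∧ b ≫ f = c ≫ a ∧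
      b ≫ eta P B = 0 := by
  obtain ⟨T', c, b, hc, h₁, h₂⟩ := exists_local_lift_of_eta hP f hf a 0 (by rw [ha, zero_comp])
  exact ⟨T', c, b, hc, h₁, by rw [h₂, comp_zero]⟩

/-- A regular epimorphism is trivial as soon as it is injective on elements killed by the unit. -/
lemma isTrivialExtension_of_forall {B A : C} (f : B ⟶ A) (hf : IsRegularEpi f)
    (h : ∀ {T : C} (x : T ⟶ B), x ≫ f = 0 → x ≫ eta P B = 0 → x = 0) :
    IsTrivialExtension P f := by
  refine ⟨hf, ?_⟩
  have w := eta_naturality P f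
  let φ : B ⟶ pullback (eta P A) (reflMap P f) := pullback.lift f (eta P B) w.symm
  have h₀ : φ ≫ pullback.fst _ _ = f := pullback.lift_fst _ _ _
  have h₁ : φ ≫ pullback.snd _ _ = eta P B := pullback.lift_snd _ _ _
  have hφ : IsRegularEpi φ := by
    obtain ⟨T', c, b, hc, hb₀, hb₁⟩ := exists_local_lift_of_eta hP f hf
      (pullback.fst (eta P A) (reflMap P f)) (pullback.snd _ _) pullback.condition
    exact isRegularEpi_of_comp b φ c (pullback.hom_ext (by rw [Category.assoc, h₀, hb₀])
      (by rw [Category.assoc, h₁, hb₁])) hc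
  have : IsIso φ := by
    apply isIso_of_kernel_eq_zero φ hφ
    apply h
    · have := congr($(kernel.condition φ) ≫ pullback.fst _ _)
      rwa [Category.assoc, h₀, zero_comp] at this
    · have := congr($(kernel.condition φ) ≫ pullback.snd _ _)
      rwa [Category.assoc, h₁, zero_comp] at this
  exact .of_iso_pullback ⟨w.symm⟩ (asIso φ) h₀ h₁

omit hP [SemiAbelian C] in
lemma IsTrivialExtension.eq_of_comp_eq {B A : C} {f : B ⟶ A} (hf : IsTrivialExtension P f) {T : C}
    (x y : T ⟶ B) (h : x ≫ f = y ≫ f) (hx : x ≫ eta P B = 0) (hy : y ≫ eta P B = 0) : x = y :=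
  hf.2.hom_ext h (by rw [hx, hy])

/-- An extension is central if and only if its kernel pair projections agree on elements killed by
the unit. -/
lemma isCentralExtension_iff {B A : C} (f : B ⟶ A) :
    IsCentralExtension P f ↔ IsRegularEpi f ∧ ∀ {T : C} (x : T ⟶ pullback f f),
      x ≫ eta P _ = 0 → x ≫ pullback.fst f f = x ≫ pullback.snd f f := by
  -- For the converse, `f` is pulled back along itself: central extensions are normal.
  refine ⟨fun ⟨hf, E, g, hg, ht⟩ => ⟨hf, fun {T} x hx => ?_⟩, fun ⟨hf, h⟩ => ⟨hf, B, f, hf, ?_⟩⟩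
  · obtain ⟨Q, a, b, hQ⟩ := exists_isPullback g (pullback.fst f f ≫ f)
    have hb : IsRegularEpi b :=
      Regular.regularEpiIsStableUnderBaseChange.of_isPullback hQ hg
    obtain ⟨T', c, z, hc, hz, hz'⟩ := exists_local_lift_comm₀ hP b hb x hx
    have := epi_of_isRegularEpi hc
    obtain ⟨l₀, hl₀, hl₀'⟩ := (IsPullback.of_hasPullback g f).exists_lift a
      (b ≫ pullback.fst f f) (by rw [hQ.w, Category.assoc])
    obtain ⟨l₁, hl₁, hl₁'⟩ := (IsPullback.of_hasPullback g f).exists_lift a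
      (b ≫ pullback.snd f f) (by rw [hQ.w, Category.assoc, pullback.condition])
    have key : z ≫ l₀ = z ≫ l₁ := ht.eq_of_comp_eq _ _
      (by rw [Category.assoc, Category.assoc, hl₀, hl₁]) (comp_eta_eq_zero P z hz' _)
      (comp_eta_eq_zero P z hz' _)
    have := congr($key ≫ pullback.snd _ _)
    rw [Category.assoc, Category.assoc, hl₀', hl₁', reassoc_of% hz, reassoc_of% hz] at this
    rwa [← cancel_epi c]
  · refine isTrivialExtension_of_forall hP _ (isRegularEpi_pullback_fst _ _ hf) fun x h₀ h₁ => ?_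
    apply pullback.hom_ext
    · rw [h₀, zero_comp]
    · rw [← h x h₁, h₀, zero_comp]

/-- The working form of centrality, used both to descend lifts to `U` and to prove them unique. -/
lemma IsCentralExtension.eq_of_comp_eq {B A Q T : C} {f : B ⟶ A} (hf : IsCentralExtension P f)
    (a b : Q ⟶ B) (w : a ≫ f = b ≫ f) (x : T ⟶ Q) (hx : x ≫ eta P Q = 0) : x ≫ a = x ≫ b := by
  obtain ⟨l, hl, hl'⟩ := (IsPullback.of_hasPullback f f).exists_lift a b w
  have := ((isCentralExtension_iff hP f).1 hf).2 (x ≫ l) (comp_eta_eq_zero P x hx l)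
  rwa [Category.assoc, Category.assoc, hl, hl'] at this

end Birkhoff

/-! ### The quotient by `[R, R]` and the Hopf formula -/

section Commutators

variable {C : Type u} [Category.{v} C] [HasZeroMorphisms C] [SemiAbelian C]
  {P : ObjectProperty C} [Reflective P.ι]

lemma isShortExact_of_forall {K X Q : C} (k : K ⟶ X) (q : X ⟶ Q) (hk : Mono k)
    (hq : IsRegularEpi q) (w : k ≫ q = 0)
    (h : ∀ {T : C} (z : T ⟶ X), z ≫ q = 0 → ∃ l : T ⟶ K, l ≫ k = z) : IsShortExact k q := by
  have := epi_of_isRegularEpi hq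
  refine ⟨w, ⟨KernelFork.IsLimit.ofι' k w fun z hz => ⟨(h z hz).choose, (h z hz).choose_spec⟩⟩, ?_⟩
  have hd : ∀ {Z : C} (g : X ⟶ Z), k ≫ g = 0 → ∃ d : Q ⟶ Z, q ≫ d = g := fun g hg => by
    obtain ⟨l, hl⟩ := h (kernel.ι q) (kernel.condition q)
    exact exists_desc_of_kernel q hq g (by rw [← hl, Category.assoc, hg, comp_zero])
  exact ⟨CokernelCofork.IsColimit.ofπ' q w fun g hg => ⟨(hd g hg).choose, (hd g hg).choose_spec⟩⟩

lemma isShortExact_kernel {X Q : C} (q : X ⟶ Q) (hq : IsRegularEpi q) :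
    IsShortExact (kernel.ι q) q :=
  isShortExact_of_forall _ q inferInstance hq (kernel.condition q)
    fun z hz => ⟨kernel.lift q z hz, kernel.lift_ι _ _ _⟩

variable (P) in
lemma comm₀Map_mu {B A : C} (f : B ⟶ A) : comm₀Map P f ≫ mu P A = mu P B ≫ f :=
  kernel.lift_ι _ _ _

variable (P) in
lemma comm₀Map_eq_id {B A : C} (f : B ⟶ A) (g : A ⟶ B) (h : f ≫ g = 𝟙 B) :
    comm₀Map P f ≫ comm₀Map P g = 𝟙 (comm₀ P B) := by
  rw [← cancel_mono (mu P B), Category.assoc, comm₀Map_mu, ← Category.assoc, comm₀Map_mu,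
    Category.assoc, h, Category.comp_id, Category.id_comp]

variable (P) in
lemma exists_lift_mu {A T : C} (x : T ⟶ A) (hx : x ≫ eta P A = 0) :
    ∃ y : T ⟶ comm₀ P A, y ≫ mu P A = x :=
  ⟨kernel.lift _ x hx, kernel.lift_ι _ _ _⟩

variable (P) in
lemma jointlyMono_comm₀Map {B A : C} (f : B ⟶ A) :
    JointlyMono₂ (comm₀Map P (pullback.fst f f)) (comm₀Map P (pullback.snd f f)) := by
  refine ⟨fun T x y h₀ h₁ => ?_⟩
  rw [← cancel_mono (mu P (pullback f f))]
  apply pullback.hom_ext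
  · rw [Category.assoc, Category.assoc, ← comm₀Map_mu, reassoc_of% h₀]
  · rw [Category.assoc, Category.assoc, ← comm₀Map_mu, reassoc_of% h₁]

variable (P) in
/-- The relation `[R, R]` on `[B, B]` induced by the kernel pair `R` of a morphism `B ⟶ A` is
effective. -/
lemma exists_isKernelPair_comm₀Map {B A : C} (f : B ⟶ A) :
    ∃ (U : C) (q : comm₀ P B ⟶ U), IsRegularEpi q ∧
      IsKernelPair q (comm₀Map P (pullback.fst f f)) (comm₀Map P (pullback.snd f f)) :=
  exists_isKernelPair_of_reflexive _ _ (jointlyMono_comm₀Map P f)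
    (comm₀Map P (pullback.diagonal f)) (comm₀Map_eq_id P _ _ (pullback.diagonal_fst f))
    (comm₀Map_eq_id P _ _ (pullback.diagonal_snd f))

variable {B A U : C} {f : B ⟶ A} {q : comm₀ P B ⟶ U}

/-- An element killed by `q` is one that `[R, R]` relates to `0`, that is, the `[f₁, f₁]`-image of
an element of the kernel of `[f₀, f₀]`. -/
lemma isBaerU_of_isKernelPair (hq : IsRegularEpi q)
    (h : IsKernelPair q (comm₀Map P (pullback.fst f f)) (comm₀Map P (pullback.snd f f))) :
    IsBaerU P f q := by
  refine isShortExact_of_forall _ q ⟨fun x y e => ?_⟩ hq ?_ fun z hz => ?_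
  · rw [← cancel_mono (kernel.ι (comm₀Map P (pullback.fst f f)))]
    apply (jointlyMono_comm₀Map P f).right_cancellation
    · rw [Category.assoc, Category.assoc, kernel.condition, comp_zero, comp_zero]
    · rwa [Category.assoc, Category.assoc]
  · rw [comm₁ToComm₀, Category.assoc, ← h.w, kernel.condition_assoc, zero_comp]
  · obtain ⟨l, hl₀, hl₁⟩ := h.lift' 0 z (by rw [zero_comp, hz])
    exact ⟨kernel.lift _ l hl₀, by rw [comm₁ToComm₀, kernel.lift_ι_assoc, hl₁]⟩

/-- A Noether isomorphism: the inverse image of `kernel u` under `q` is `K ∧ [B, B]`, since `q ≫ u =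
mu P B ≫ f`. -/
lemma exists_isHopfH₂ (h : IsBaerU P f q) (hq : IsRegularEpi q) (u : U ⟶ A)
    (hu : q ≫ u = mu P B ≫ f) :
    ∃ r : meet P f ⟶ kernel u, IsHopfH₂ P f r ∧ r ≫ kernel.ι u = meetToComm₀ P f ≫ q := by
  obtain ⟨w, ⟨hk⟩, -⟩ := h
  have hw : meetToComm₀ P f ≫ mu P B = pullback.fst (kernel.ι f) (mu P B) ≫ kernel.ι f :=
    pullback.condition.symm
  have hm : comm₁ToMeet P f ≫ meetToComm₀ P f = comm₁ToComm₀ P f := pullback.lift_snd _ _ _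
  have hmono : Mono (meetToComm₀ P f) := inferInstance
  have hr : (meetToComm₀ P f ≫ q) ≫ u = 0 := by
    rw [Category.assoc, hu, reassoc_of% hw, kernel.condition, comp_zero]
  have hrι : kernel.lift u _ hr ≫ kernel.ι u = meetToComm₀ P f ≫ q := kernel.lift_ι _ _ _
  refine ⟨kernel.lift u _ hr, isShortExact_of_forall _ _ ?_ ?_ ?_ fun z hz => ?_, hrι⟩
  · have : Mono (comm₁ToComm₀ P f) := mono_of_isLimit_fork hk
    exact mono_of_mono_fac hm
  · obtain ⟨T, c, y, hc, hy⟩ := exists_local_lift q hq (kernel.ι u)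
    obtain ⟨x, hx, hx'⟩ := (IsPullback.of_hasPullback (kernel.ι f) (mu P B)).exists_lift
      (kernel.lift f (y ≫ mu P B) (by
        rw [Category.assoc, ← hu, reassoc_of% hy, kernel.condition, comp_zero])) y
      (kernel.lift_ι _ _ _)
    refine isRegularEpi_of_comp x _ c ?_ hc
    rw [← cancel_mono (kernel.ι u), Category.assoc, hrι, reassoc_of% hx', hy]
  · rw [← cancel_mono (kernel.ι u), Category.assoc, hrι, reassoc_of% hm, w, zero_comp]
  · obtain ⟨l, hl⟩ := KernelFork.IsLimit.lift' hk (z ≫ meetToComm₀ P f) (by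
      rw [Category.assoc, ← hrι, reassoc_of% hz, zero_comp])
    refine ⟨l, ?_⟩
    rw [← cancel_mono (meetToComm₀ P f), Category.assoc, hm]
    exact hl

/-! ### Perfectness, centrality and universality -/

variable (hP : IsBirkhoff P)

include hP

lemma isRegularEpi_mu_comp (hA : IsPerfect P A) (hf : IsRegularEpi f) :
    IsRegularEpi (mu P B ≫ f) := by
  obtain ⟨T, c, b, hc, hb, hb'⟩ := exists_local_lift_comm₀ hP f hf (𝟙 A)
    (by rw [(isPerfect_iff P A).1 hA, comp_zero])
  obtain ⟨y, rfl⟩ := exists_lift_mu P b hb'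
  exact isRegularEpi_of_comp y _ c (by rw [← Category.assoc, hb, Category.comp_id]) hc

omit hP in
/-- Two elements of `[B, B]` coming from an element of `[R, R]`, where `R` is the
kernel pair of `f`, are identified by `[B, B] ⟶ [B, B] / [K, B]`. -/
lemma comp_eq_of_isKernelPair
    (h : IsKernelPair q (comm₀Map P (pullback.fst f f)) (comm₀Map P (pullback.snd f f)))
    {S T : C} (a b : S ⟶ B) (w : a ≫ f = b ≫ f) (x : T ⟶ S) (hx : x ≫ eta P S = 0)
    (y z : T ⟶ comm₀ P B) (hy : y ≫ mu P B = x ≫ a) (hz : z ≫ mu P B = x ≫ b) :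
    y ≫ q = z ≫ q := by
  obtain ⟨l, hl, hl'⟩ := (IsPullback.of_hasPullback f f).exists_lift a b w
  obtain ⟨m, hm⟩ := exists_lift_mu P (x ≫ l) (comp_eta_eq_zero P x hx l)
  have h₀ : m ≫ comm₀Map P (pullback.fst f f) = y := by
    rw [← cancel_mono (mu P B), Category.assoc, comm₀Map_mu, reassoc_of% hm, hl, hy]
  have h₁ : m ≫ comm₀Map P (pullback.snd f f) = z := by
    rw [← cancel_mono (mu P B), Category.assoc, comm₀Map_mu, reassoc_of% hm, hl', hz]
  rw [← h₀, ← h₁, Category.assoc, Category.assoc, h.w]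

lemma isPerfect_of_isKernelPair (hA : IsPerfect P A) (hf : IsRegularEpi f) (hq : IsRegularEpi q)
    (h : IsKernelPair q (comm₀Map P (pullback.fst f f)) (comm₀Map P (pullback.snd f f))) :
    IsPerfect P U := by
  rw [isPerfect_iff]
  obtain ⟨S, a, b, hS⟩ := exists_isPullback (mu P B ≫ f) f
  have hb : IsRegularEpi b := Regular.regularEpiIsStableUnderBaseChange.of_isPullback hS
    (isRegularEpi_mu_comp hP hA hf)
  -- An element of `[B, B]` lifts to `[S, S]`; its other coordinate lies in `[[B, B], [B, B]]` and
  -- has the same image under `q`. So `U` is covered by `[U, U]`.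
  obtain ⟨T, c, x, hc, hx, hx'⟩ := exists_local_lift_comm₀ hP b hb (mu P B) (kernel.condition _)
  have hcq := isRegularEpi_comp c q hc hq
  have := epi_of_isRegularEpi hcq
  have key : (x ≫ a) ≫ q = c ≫ q := comp_eq_of_isKernelPair h (a ≫ mu P B) b
    (by rw [Category.assoc, hS.w]) x hx' _ _ (Category.assoc _ _ _) hx.symm
  rw [← cancel_epi (c ≫ q), ← key, comp_zero]
  exact comp_eta_eq_zero P _ (comp_eta_eq_zero P x hx' a) q

lemma isCentralExtension_of_isKernelPair (hq : IsRegularEpi q)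
    (h : IsKernelPair q (comm₀Map P (pullback.fst f f)) (comm₀Map P (pullback.snd f f)))
    (u : U ⟶ A) (hu : q ≫ u = mu P B ≫ f) (hu' : IsRegularEpi u) : IsCentralExtension P u := by
  rw [isCentralExtension_iff hP]
  refine ⟨hu', fun {T} x hx => ?_⟩
  obtain ⟨S₀, a₀, b₀, h₀⟩ := exists_isPullback q (pullback.fst u u)
  obtain ⟨S₁, a₁, b₁, h₁⟩ := exists_isPullback q (pullback.snd u u)
  have hb₀ : IsRegularEpi b₀ := Regular.regularEpiIsStableUnderBaseChange.of_isPullback h₀ hq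
  have hb₁ : IsRegularEpi b₁ := Regular.regularEpiIsStableUnderBaseChange.of_isPullback h₁ hq
  -- `S` covers the kernel pair of `u` by adding lifts of both coordinates to `[B, B]`, so that
  -- `comp_eq_of_isKernelPair` applies.
  obtain ⟨S, s₀, s₁, hS⟩ := exists_isPullback b₀ b₁
  have hs : IsRegularEpi (s₁ ≫ b₁) := isRegularEpi_comp _ _
    (Regular.regularEpiIsStableUnderBaseChange.of_isPullback hS hb₀) hb₁
  obtain ⟨T', c, y, hc, hy, hy'⟩ := exists_local_lift_comm₀ hP _ hs x hx
  have := epi_of_isRegularEpi hc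
  have key := comp_eq_of_isKernelPair h (s₀ ≫ a₀ ≫ mu P B) (s₁ ≫ a₁ ≫ mu P B)
    (by
      simp only [Category.assoc]
      rw [← hu, h₀.w_assoc, h₁.w_assoc, pullback.condition, hS.w_assoc]) y hy'
    (y ≫ s₀ ≫ a₀) (y ≫ s₁ ≫ a₁) (by simp only [Category.assoc]) (by simp only [Category.assoc])
  rw [← cancel_epi c, ← reassoc_of% hy, ← reassoc_of% hy, ← h₁.w, ← hS.w_assoc, ← h₀.w]
  simpa only [Category.assoc] using key

lemma isUniversalCentralExtension_of_isKernelPair (hA : IsPerfect P A)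
    (hf : IsProjectivePresentation f) (hq : IsRegularEpi q)
    (h : IsKernelPair q (comm₀Map P (pullback.fst f f)) (comm₀Map P (pullback.snd f f)))
    (u : U ⟶ A) (hu : q ≫ u = mu P B ≫ f) (hu' : IsRegularEpi u) :
    IsUniversalCentralExtension P u := by
  refine ⟨isCentralExtension_of_isKernelPair hP hq h u hu hu', fun {V} v hv => ?_⟩
  have := epi_of_isRegularEpi hq
  obtain ⟨b, hb⟩ := hf.1 f v hv.1
  have hqv : comm₀Map P (pullback.fst f f) ≫ mu P B ≫ b =
      comm₀Map P (pullback.snd f f) ≫ mu P B ≫ b := by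
    have := hv.eq_of_comp_eq hP (pullback.fst f f ≫ b) (pullback.snd f f ≫ b)
      (by rw [Category.assoc, Category.assoc, hb, pullback.condition]) (mu P _) (kernel.condition _)
    rwa [← Category.assoc, ← Category.assoc, ← comm₀Map_mu, ← comm₀Map_mu, Category.assoc,
      Category.assoc] at this
  obtain ⟨t, ht⟩ := IsRegularEpi.exists_of_isKernelPair q h (mu P B ≫ b) hqv
  have htv : t ≫ v = u := by rw [← cancel_epi q, reassoc_of% ht, hb, hu]
  refine ⟨t, htv, fun t' ht' => ?_⟩
  have hU := (isPerfect_iff P U).1 (isPerfect_of_isKernelPair hP hA hf.2 hq h)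
  -- As `U` is perfect, its generic element `𝟙 U` is killed by the unit, so centrality of `v`
  -- applies to it.
  have := hv.eq_of_comp_eq hP t' t (ht'.trans htv.symm) (𝟙 U) (by rw [hU, comp_zero])
  rwa [Category.id_comp, Category.id_comp] at this

/-- The projection from a product with an object of the Birkhoff subcategory is central. -/
lemma isCentralExtension_prod_fst (A X : C) (hX : P X) :
    IsCentralExtension P (prod.fst : A ⨯ X ⟶ A) := by
  have hker : ∀ {S T : C} (x : T ⟶ S) (g : S ⟶ X), x ≫ eta P S = 0 → x ≫ g = 0 := by
    intro S T x g hx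
    obtain ⟨k, rfl⟩ := exists_refl_desc P hX g
    rw [reassoc_of% hx, zero_comp]
  rw [isCentralExtension_iff hP]
  refine ⟨isRegularEpi_of_section _ (prod.lift (𝟙 A) 0) (prod.lift_fst _ _), fun x hx => ?_⟩
  apply Limits.prod.hom_ext
  · rw [Category.assoc, Category.assoc, pullback.condition]
  · rw [Category.assoc, Category.assoc, hker x _ hx, hker x _ hx]

lemma isPerfect_of_isUniversalCentralExtension (u : U ⟶ A)
    (hu : IsUniversalCentralExtension P u) : IsPerfect P A := by
  rw [isPerfect_iff]
  have := epi_of_isRegularEpi hu.1.1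
  have h := (hu.2 _ (isCentralExtension_prod_fst hP A _ (prop_refl P A))).unique
    (prod.lift_fst u (u ≫ eta P A)) (prod.lift_fst u 0)
  have := congr($h ≫ prod.snd)
  rw [prod.lift_snd, prod.lift_snd] at this
  rw [← cancel_epi u, this, comp_zero]

end Commutators

end SemiAbelian

theorem mainTheorem1 {C : Type u} [Category.{v} C] [HasZeroMorphisms C] [SemiAbelian C]
    (hproj : SemiAbelian.EnoughRegularProjectives C)
    (P : ObjectProperty C) [Reflective P.ι] (hP : SemiAbelian.IsBirkhoff P) (A : C) :
    (SemiAbelian.IsPerfect P A ↔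
      ∃ (U : C) (u : U ⟶ A), SemiAbelian.IsUniversalCentralExtension P u) ∧
    (SemiAbelian.IsPerfect P A →
      ∀ {B : C} (f : B ⟶ A), SemiAbelian.IsProjectivePresentation f →
        ∃ (U H : C) (q : SemiAbelian.comm₀ P B ⟶ U) (r : SemiAbelian.meet P f ⟶ H)
          (i : H ⟶ U) (u : U ⟶ A),
          SemiAbelian.IsBaerU P f q ∧
          SemiAbelian.IsHopfH₂ P f r ∧
          r ≫ i = SemiAbelian.meetToComm₀ P f ≫ q ∧
          q ≫ u = SemiAbelian.mu P B ≫ f ∧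
          SemiAbelian.IsShortExact i u ∧
          SemiAbelian.IsUniversalCentralExtension P u) := by
  have key : SemiAbelian.IsPerfect P A →
      ∀ {B : C} (f : B ⟶ A), SemiAbelian.IsProjectivePresentation f →
        ∃ (U H : C) (q : SemiAbelian.comm₀ P B ⟶ U) (r : SemiAbelian.meet P f ⟶ H)
          (i : H ⟶ U) (u : U ⟶ A),
          SemiAbelian.IsBaerU P f q ∧
          SemiAbelian.IsHopfH₂ P f r ∧
          r ≫ i = SemiAbelian.meetToComm₀ P f ≫ q ∧
          q ≫ u = SemiAbelian.mu P B ≫ f ∧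
          SemiAbelian.IsShortExact i u ∧
          SemiAbelian.IsUniversalCentralExtension P u := by
    intro hA B f hf
    obtain ⟨U, q, hq, h⟩ := SemiAbelian.exists_isKernelPair_comm₀Map P f
    obtain ⟨u, hu⟩ := IsRegularEpi.exists_of_isKernelPair q h (SemiAbelian.mu P B ≫ f) (by
      rw [← Category.assoc, ← Category.assoc, SemiAbelian.comm₀Map_mu, SemiAbelian.comm₀Map_mu,
        Category.assoc, Category.assoc, pullback.condition])
    have hu' : IsRegularEpi u := SemiAbelian.isRegularEpi_of_comp q u _ hu
      (SemiAbelian.isRegularEpi_mu_comp hP hA hf.2)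
    have hU := SemiAbelian.isBaerU_of_isKernelPair hq h
    obtain ⟨r, hr, hr'⟩ := SemiAbelian.exists_isHopfH₂ hU hq u hu
    exact ⟨U, _, q, r, kernel.ι u, u, hU, hr, hr', hu, SemiAbelian.isShortExact_kernel u hu',
      SemiAbelian.isUniversalCentralExtension_of_isKernelPair hP hA hf hq h u hu hu'⟩
  refine ⟨⟨fun hA => ?_, fun ⟨U, u, hu⟩ =>
    SemiAbelian.isPerfect_of_isUniversalCentralExtension hP u hu⟩, key⟩
  obtain ⟨B, f, hf⟩ := hproj A
  obtain ⟨U, -, -, -, -, u, -, -, -, -, -, hu⟩ := key hA f hf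
  exact ⟨U, u, hu⟩
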